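/- Let $X$ be a Polish space. Let $F_{\aleph_0}(X)$ be the family of countable closed subsets of $X$. If $D$ is a map on the subsets of a set with $D(A)\subseteq A$, put $D^0(A)=A$, $D^{\alpha+1}(A)=D(D^\alpha(A))$ and $D^\lambda(A)=\bigcap_{\beta<\lambda}D^\beta(A)$ for limit $\lambda$, and let $|A|_D$ be the least ordinal $\alpha$ with $D^\alpha(A)=D^{\alpha+1}(A)$. The Cantor–Bendixson rank $|F|_{\mathrm{CB}}$ of a closed $F\subseteq X$ is $|F|_D$ for the derivative $D(F)=\{x\in F\mid x\text{ is a limit point of }F\}$. A presentation $\mathcal P=(X,d,(x_i)_{i\in\omega})$ of $X$ consists of a complete metric $d$ on $X$ inducing its topology and a dense sequence $(x_i)_{i\in\omega}$ in $X$. For $n=(n(0),n(1))\in\omega^2$ let $B(n)$ and $\overline B(n)$ be the open ball $\{x\mid d(x,x_{n(0)})<2^{-n(1)-1}\}$ and the closed ball $\{x\mid d(x,x_{n(0)})\le 2^{-n(1)-1}\}$. Write $n\prec m$ if $n(1)<m(1)$ and $\overline B(m)\subseteq B(n)$, and for $A\subseteq\omega^2$ let $$D_{\mathcal P}(A)=\{n\in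 A\mid \exists u,v\in A:\ n\prec u,\ n\prec v,\ \overline B(u)\cap\overline B(v)=\emptyset\}.$$ For $F\in F_{\aleph_0}(X)$ let $\varphi_{\mathcal P}(F)=|A_F|_{D_{\mathcal P}}$, where $A_F=\{n\in\omega^2\mid B(n)\cap F\neq\emptyset\}$. The following are equivalent: 1. $X$ is compact. 2. The family $(\varphi_{\mathcal P})_{\mathcal P}$, where $\mathcal P$ ranges over all presentations of $X$, is uniformly bounded by the Cantor–Bendixson rank: there is $f\colon\omega_1\to\omega_1$ such that $\varphi_{\mathcal P}(F)\le f(|F|_{\mathrm{CB}})$ for every presentation $\mathcal P$ of $X$ and every $F\in F_{\aleph_0}(X)$. 3. $\varphi_{\mathcal P}(F)<\omega\cdot|F|_{\mathrm{CB}}$ for every presentation $\mathcal P$ of $X$ and every non-empty $F\in F_{\aleph_0}(X)$. Moreover, if $X$ is not compact, then for every infinite closed discrete subset $F\subseteq X$ and every $\alpha<\omega_1$ there is a presentation $\mathcal P_\alpha$ of $X$ with $\varphi_{\mathcal P_\alpha}(F)\ge\alpha$. -/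

import Mathlib

open Set Filter Topology
open scoped Ordinal

noncomputable section

/-- The transfinite iterates `D^o(A)` of a map `D` on the subsets of a type: `D^0(A) = A`,
`D^(o+1)(A) = D (D^o(A))`, and `D^o(A) = ⋂ b < o, D^b(A)` for limit ordinals `o`. -/
def iterDeriv {S : Type*} (D : Set S → Set S) (A : Set S) (o : Ordinal.{0}) : Set S :=
  Ordinal.limitRecOn o A (fun _ B => D B) (fun o _ ih => ⋂ b : Set.Iio o, ih b.1 b.2)

theorem iterDeriv_zero {S : Type*} (D : Set S → Set S) (A : Set S) :
    iterDeriv D A 0 = A := by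
  simp [iterDeriv]

theorem iterDeriv_add_one {S : Type*} (D : Set S → Set S) (A : Set S) (o : Ordinal.{0}) :
    iterDeriv D A (o + 1) = D (iterDeriv D A o) := by
  simp [iterDeriv]

theorem iterDeriv_limit {S : Type*} (D : Set S → Set S) (A : Set S) (o : Ordinal.{0})
    (ho : Order.IsSuccLimit o) :
    iterDeriv D A o = ⋂ b : Set.Iio o, iterDeriv D A b.1 := by
  simp only [iterDeriv]
  rw [Ordinal.limitRecOn_limit _ _ _ _ ho]

/-- The least ordinal `o` with `D^o(A) = D^(o+1)(A)`. For the derivatives used below the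
iterates stabilize at a countable ordinal, so that the infimum is attained and ordinals of
the lowest universe suffice. -/
def derivRank {S : Type*} (D : Set S → Set S) (A : Set S) : Ordinal.{0} :=
  sInf {o | iterDeriv D A o = iterDeriv D A (o + 1)}

/-- The Cantor–Bendixson derivative: the points of `F` that are limit points of `F`. -/
def cbDeriv {X : Type*} [TopologicalSpace X] (F : Set X) : Set X :=
  {x | x ∈ F ∧ AccPt x (𝓟 F)}

/-- The Cantor–Bendixson rank `|F|_CB`. -/
def cbRank {X : Type*} [TopologicalSpace X] (F : Set X) : Ordinal.{0} :=
  derivRank cbDeriv F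

/-- The family of countable closed subsets of `X`. -/
def countableClosed (X : Type*) [TopologicalSpace X] : Set (Set X) :=
  {F | IsClosed F ∧ F.Countable}

/-- A presentation of a topological space `X`: a complete metric inducing the topology of `X`
and a dense sequence in `X`. -/
structure Presentation (X : Type*) [t : TopologicalSpace X] where
  metric : MetricSpace X
  compatible : metric.toUniformSpace.toTopologicalSpace = t
  complete : @CompleteSpace X metric.toUniformSpace
  seq : ℕ → X
  dense : DenseRange seq

namespace Presentation

variable {X : Type*} [TopologicalSpace X]

/-- The open ball with centre `x_{n(0)}` and radius `2^{-n(1)-1}`. -/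
def openBall (P : Presentation X) (n : ℕ × ℕ) : Set X :=
  {x | P.metric.dist x (P.seq n.1) < (1 / 2 : ℝ) ^ (n.2 + 1)}

/-- The closed ball with centre `x_{n(0)}` and radius `2^{-n(1)-1}`. -/
def closedBall (P : Presentation X) (n : ℕ × ℕ) : Set X :=
  {x | P.metric.dist x (P.seq n.1) ≤ (1 / 2 : ℝ) ^ (n.2 + 1)}

/-- The relation `n ≺ m`. -/
def Prec (P : Presentation X) (n m : ℕ × ℕ) : Prop :=
  n.2 < m.2 ∧ P.closedBall m ⊆ P.openBall n

/-- The relation `n ⋏ m`: the two closed balls are disjoint. -/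
def Incomp (P : Presentation X) (n m : ℕ × ℕ) : Prop :=
  P.closedBall n ∩ P.closedBall m = ∅

/-- The set `A_F` of all indices whose open ball meets `F`. -/
def code (P : Presentation X) (F : Set X) : Set (ℕ × ℕ) :=
  {n | (P.openBall n ∩ F).Nonempty}

/-- The derivative `D_P` on sets of indices. -/
def deriv (P : Presentation X) (A : Set (ℕ × ℕ)) : Set (ℕ × ℕ) :=
  {n | n ∈ A ∧ ∃ u ∈ A, ∃ v ∈ A, P.Prec n u ∧ P.Prec n v ∧ P.Incomp u v}

/-- The rank `φ_P(F)`: the length of the iteration of `D_P` on `A_F`. -/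
def rank (P : Presentation X) (F : Set X) : Ordinal.{0} :=
  derivRank P.deriv (P.code F)

end Presentation

/-- The family `φ` of ranks on `A` is uniformly bounded by the rank `ψ`: there is a function
`f : ω₁ → ω₁` with `φ i x ≤ f (ψ x)` for all indices `i` and all `x ∈ A`. -/
def UniformlyBoundedBy {ι S : Type*} (φ : ι → S → Ordinal.{0}) (ψ : S → Ordinal.{0})
    (A : Set S) : Prop :=
  ∃ f : Ordinal.{0} → Ordinal.{0}, (∀ a < ω₁, f a < ω₁) ∧
    ∀ i, ∀ x ∈ A, φ i x ≤ f (ψ x)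

end

/-!
Write `F^(a)` for the iterated Cantor–Bendixson derivatives of `F`.

**Compact spaces.** Suppose that the closed ball with index `n` meets `K = F^(a)` whenever `n`
survives `o` derivatives of the code of `F`. If `n` survives `o + k` derivatives, then its ball
contains two disjoint balls whose indices survive `o + k - 1` derivatives, and so, by induction on
`k`, it meets `K` in more than `k` points (`Presentation.lt_encard_of_mem_iterDeriv`). A closed ball
that misses `F^(a + 1)` meets `F^(a)` in a finite set by compactness, hence its index is removed
within `ω` further derivatives. By induction, indices surviving `ω * a` derivatives belong to
balls meeting `F^(a)` (`Presentation.closedBall_inter_nonempty_of_mem_iterDeriv`). If `F` is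
countable and nonempty, its rank is a successor `b + 1` by compactness, and `F^(b)` is finite, so
that the iteration on the code ends after finitely many steps beyond `ω * b`.

**Noncompact spaces.** Let `F` be infinite, closed and discrete. Any complete metric can be changed
so that the points of `F` have mutual distance at least `1` (`exists_metricSpace_one_le_dist`).
Distances along an injection of a complete metric space `T` of diameter at most `1` into `F` can
then be shortened to those of `T`, by allowing paths to take a shortcut through `T`; this keeps
completeness and topology (`exists_metricSpace_dist_apply_apply`). For `T` one takes the tree of
descending sequences of ordinals below a countable ordinal `α`, with an ultrametric for which the
distance of two sequences depends on the length of their common beginning. It is complete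
because the tree is well-founded. With suitable radii the balls about the children of a sequence are
contained in the ball about the sequence and are pairwise disjoint, so that a sequence with last
entry `w` survives `w` derivatives (`Presentation.mem_iterDeriv_of_isometric`). Since the code of a
closed discrete set vanishes under iteration (`Presentation.eq_empty_of_deriv_eq`), the rank is at
least `α`. As closed discrete sets have Cantor–Bendixson rank at most `1`, this contradicts any
uniform bound.
-/

/-! ### Transfinite iterates of a derivative -/

section Iterates

variable {S : Type*} {D : Set S → Set S}

theorem iterDeriv_antitone (hD : ∀ A, D A ⊆ A) (A : Set S) : Antitone (iterDeriv D A) := by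
  intro a b hab
  induction b using Ordinal.limitRecOn with
  | zero => rw [nonpos_iff_eq_zero.1 hab]
  | add_one b ih =>
    rcases hab.lt_or_eq with h | rfl
    · rw [iterDeriv_add_one]
      exact (hD _).trans (ih (Order.lt_add_one_iff.1 h))
    · exact le_rfl
  | limit b hb ih =>
    rcases hab.lt_or_eq with h | rfl
    · rw [iterDeriv_limit _ _ _ hb]
      exact iInter_subset (fun c : Iio b => iterDeriv D A c.1) ⟨a, h⟩
    · exact le_rfl

theorem iterDeriv_subset (hD : ∀ A, D A ⊆ A) (A : Set S) (o : Ordinal) :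
    iterDeriv D A o ⊆ A := by
  simpa [iterDeriv_zero] using iterDeriv_antitone hD A (zero_le (a := o))

/-- The iterates of a derivative on a countable set stabilize: there are more ordinals than
subsets of a countable set. -/
theorem iterDeriv_derivRank (hD : ∀ A, D A ⊆ A) {A : Set S} (hA : A.Countable) :
    iterDeriv D A (derivRank D A + 1) = iterDeriv D A (derivRank D A) := by
  suffices h : {o | iterDeriv D A o = iterDeriv D A (o + 1)}.Nonempty from (csInf_mem h).symm
  obtain ⟨e, he⟩ := countable_iff_exists_injOn.1 hA
  have := not_injective_of_ordinal.{0} (fun o : Ordinal.{0} => e '' iterDeriv D A o)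
  rw [Function.Injective] at this
  push Not at this
  obtain ⟨a, b, hab, hne⟩ := this
  have key : ∀ a b : Ordinal.{0}, a < b → e '' iterDeriv D A a = e '' iterDeriv D A b →
      iterDeriv D A a = iterDeriv D A (a + 1) := by
    intro a b h heq
    have h1 : iterDeriv D A a = iterDeriv D A b :=
      (he.image_eq_image_iff (iterDeriv_subset hD A a) (iterDeriv_subset hD A b)).1 heq
    refine subset_antisymm ?_ (iterDeriv_antitone hD A le_self_add)
    rw [h1]
    exact iterDeriv_antitone hD A (Order.add_one_le_of_lt h)
  rcases lt_or_gt_of_ne hne with h | h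
  · exact ⟨a, key a b h hab⟩
  · exact ⟨b, key b a h hab.symm⟩

theorem derivRank_le {A : Set S} {o : Ordinal}
    (h : iterDeriv D A o = iterDeriv D A (o + 1)) : derivRank D A ≤ o :=
  csInf_le' h

theorem derivRank_le_of_eq_empty (hD : ∀ A, D A ⊆ A) {A : Set S} {o : Ordinal}
    (h : iterDeriv D A o = ∅) : derivRank D A ≤ o := by
  refine derivRank_le ?_
  rw [iterDeriv_add_one, h]
  exact (subset_empty_iff.1 (hD ∅)).symm

end Iterates

/-! ### The Cantor–Bendixson derivative -/

section CantorBendixson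

variable {X : Type*} [TopologicalSpace X]

theorem cbDeriv_subset (F : Set X) : cbDeriv F ⊆ F := fun _ hx => hx.1

theorem isClosed_cbDeriv [T1Space X] {F : Set X} (hF : IsClosed F) : IsClosed (cbDeriv F) :=
  hF.inter (isClosed_derivedSet F)

theorem isClosed_iterDeriv_cbDeriv [T1Space X] {F : Set X} (hF : IsClosed F) (o : Ordinal) :
    IsClosed (iterDeriv cbDeriv F o) := by
  induction o using Ordinal.limitRecOn with
  | zero => rwa [iterDeriv_zero]
  | add_one b ih => rw [iterDeriv_add_one]; exact isClosed_cbDeriv ih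
  | limit b hb ih =>
    rw [iterDeriv_limit _ _ _ hb]
    exact isClosed_iInter fun c => ih c.1 c.2

/-- A countable closed subset of a Polish space without isolated points is empty. -/
theorem eq_empty_of_cbDeriv_eq [PolishSpace X] {F : Set X} (hF : IsClosed F) (hc : F.Countable)
    (h : cbDeriv F = F) : F = ∅ := by
  by_contra hne
  let := TopologicalSpace.upgradeIsCompletelyMetrizable X
  have hp : Perfect F := ⟨hF, fun x hx => (h.symm ▸ hx : x ∈ cbDeriv F).2⟩
  obtain ⟨f, hf, -, hinj⟩ := hp.exists_nat_bool_injection (nonempty_iff_ne_empty.2 hne)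
  have h1 : (univ : Set (ℕ → Bool)).Countable :=
    countable_of_injective_of_countable_image hinj.injOn
      (hc.mono (by rwa [image_univ]))
  rw [countable_univ_iff, ← Cardinal.mk_le_aleph0_iff] at h1
  exact (Cardinal.cantor Cardinal.aleph0).not_ge (by simpa using h1)

theorem iterDeriv_cbRank [PolishSpace X] {F : Set X} (hF : F ∈ countableClosed X) :
    iterDeriv cbDeriv F (cbRank F) = ∅ := by
  refine eq_empty_of_cbDeriv_eq (isClosed_iterDeriv_cbDeriv hF.1 _)
    (hF.2.mono (iterDeriv_subset cbDeriv_subset _ _)) ?_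
  exact (iterDeriv_add_one _ _ _).symm.trans <| iterDeriv_derivRank cbDeriv_subset hF.2

/-- By compactness, the iterated derivatives cannot vanish for the first time at a limit
ordinal. -/
theorem exists_cbRank_eq_add_one [PolishSpace X] [CompactSpace X] {F : Set X}
    (hF : F ∈ countableClosed X) (hne : F.Nonempty) : ∃ b, cbRank F = b + 1 := by
  rcases Ordinal.zero_or_succ_or_isSuccLimit (cbRank F) with h | ⟨b, h⟩ | h
  · have := iterDeriv_cbRank hF
    rw [h, iterDeriv_zero] at this
    exact absurd this hne.ne_empty
  · exact ⟨b, h.symm⟩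
  · exfalso
    have h0 := iterDeriv_cbRank hF
    rw [iterDeriv_limit _ _ _ h] at h0
    have : Nonempty (Iio (cbRank F)) := ⟨⟨0, h.bot_lt⟩⟩
    refine (IsCompact.nonempty_iInter_of_directed_nonempty_isCompact_isClosed
      (fun c : Iio (cbRank F) => iterDeriv cbDeriv F c.1) ?_ ?_
      (fun c => (isClosed_iterDeriv_cbDeriv hF.1 _).isCompact)
      (fun c => isClosed_iterDeriv_cbDeriv hF.1 _)).ne_empty h0
    · exact directed_of_isDirected_le fun a b hab => iterDeriv_antitone cbDeriv_subset F hab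
    · intro c
      by_contra hc
      exact absurd (derivRank_le_of_eq_empty cbDeriv_subset (not_nonempty_iff_eq_empty.1 hc))
        (not_le.2 c.2)

theorem Set.finite_of_inter_cbDeriv_eq_empty [CompactSpace X] {C K : Set X} (hC : IsClosed C)
    (hK : IsClosed K) (h : C ∩ cbDeriv K = ∅) : (C ∩ K).Finite := by
  by_contra hinf
  obtain ⟨x, hx, hacc⟩ := Set.Infinite.exists_accPt_of_subset_isCompact hinf
    (hC.inter hK).isCompact le_rfl
  exact (h.subset ⟨hx.1, hx.2, hacc.mono (principal_mono.2 inter_subset_right)⟩).elim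

theorem cbRank_le_one {F : Set X} (hd : DiscreteTopology F) : cbRank F ≤ 1 := by
  refine derivRank_le_of_eq_empty cbDeriv_subset ?_
  rw [← zero_add (1 : Ordinal), iterDeriv_add_one, iterDeriv_zero]
  refine eq_empty_of_forall_notMem fun x hx => ?_
  exact hx.2.ne (discreteTopology_subtype_iff.1 hd x hx.1)

theorem exists_infinite_isClosed_discreteTopology [PolishSpace X] (hX : ¬ CompactSpace X) :
    ∃ F : Set X, IsClosed F ∧ DiscreteTopology F ∧ F.Infinite := by
  let := TopologicalSpace.upgradeIsCompletelyMetrizable X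
  by_contra! hcon
  refine hX ⟨?_⟩
  refine IsSeqCompact.isCompact (IsCountablyCompact.isSeqCompact ?_)
  rw [isCountablyCompact_iff_infinite_subset_has_accPt]
  intro B _ hB
  by_contra! hno
  have hcl : IsClosed B := by
    rw [isClosed_iff_derivedSet_subset]
    exact fun x hx => (hno x (mem_univ x) hx).elim
  refine hB (hcon B hcl ?_)
  rw [discreteTopology_subtype_iff]
  intro x _
  by_contra h
  exact hno x (mem_univ x) ⟨h⟩

end CantorBendixson

/-! ### The rank of a presentation of a compact space -/

namespace Presentation

variable {X : Type*} [TopologicalSpace X] (P : Presentation X)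

theorem deriv_subset (A : Set (ℕ × ℕ)) : P.deriv A ⊆ A := fun _ hn => hn.1

theorem openBall_subset_closedBall (n : ℕ × ℕ) : P.openBall n ⊆ P.closedBall n :=
  fun _ hx => le_of_lt (mem_ofPred.1 hx)

theorem isClosed_closedBall (n : ℕ × ℕ) : IsClosed (P.closedBall n) := by
  obtain ⟨m, rfl, -, s, -⟩ := P
  exact Metric.isClosed_closedBall (x := s n.1) (ε := (1 / 2 : ℝ) ^ (n.2 + 1))

variable {P} in
theorem Prec.closedBall_subset {n m : ℕ × ℕ} (h : P.Prec n m) :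
    P.closedBall m ⊆ P.closedBall n :=
  h.2.trans (P.openBall_subset_closedBall n)

/-- If all closed balls with index in `A` meet `K`, then a closed ball whose index survives `k`
derivatives meets `K` in more than `k` points: it contains two disjoint balls whose indices
survive `k - 1` derivatives. -/
theorem lt_encard_of_mem_iterDeriv {A : Set (ℕ × ℕ)} {K : Set X} {o : Ordinal}
    (hA : ∀ n ∈ iterDeriv P.deriv A o, (P.closedBall n ∩ K).Nonempty) (k : ℕ) :
    ∀ n ∈ iterDeriv P.deriv A (o + k), ((k + 1 : ℕ) : ℕ∞) ≤ (P.closedBall n ∩ K).encard := by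
  induction k with
  | zero =>
    intro n hn
    simpa [one_le_encard_iff_nonempty] using hA n (by simpa using hn)
  | succ k ih =>
    intro n hn
    rw [Nat.cast_succ, ← add_assoc, iterDeriv_add_one] at hn
    obtain ⟨-, u, hu, v, hv, hnu, hnv, huv⟩ := hn
    have hv0 := hA v (iterDeriv_antitone P.deriv_subset A le_self_add hv)
    have hdisj : Disjoint (P.closedBall u ∩ K) (P.closedBall v ∩ K) :=
      (disjoint_iff_inter_eq_empty.2 huv).mono inter_subset_left inter_subset_left
    calc ((k + 1 + 1 : ℕ) : ℕ∞) = ((k + 1 : ℕ) : ℕ∞) + 1 := by push_cast; rfl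
      _ ≤ (P.closedBall u ∩ K).encard + (P.closedBall v ∩ K).encard :=
        add_le_add (ih u hu) (one_le_encard_iff_nonempty.2 hv0)
      _ = ((P.closedBall u ∩ K) ∪ (P.closedBall v ∩ K)).encard := (encard_union_eq hdisj).symm
      _ ≤ (P.closedBall n ∩ K).encard := encard_le_encard <| union_subset
        (inter_subset_inter_left _ (Prec.closedBall_subset hnu))
        (inter_subset_inter_left _ (Prec.closedBall_subset hnv))

variable [T1Space X] [CompactSpace X] {F : Set X}

/-- In a compact space, every `ω` derivatives of the code of `F` account for one
Cantor–Bendixson derivative of `F`. -/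
theorem closedBall_inter_nonempty_of_mem_iterDeriv (hF : IsClosed F) (a : Ordinal) :
    ∀ n ∈ iterDeriv P.deriv (P.code F) (ω * a),
      (P.closedBall n ∩ iterDeriv cbDeriv F a).Nonempty := by
  induction a using Ordinal.limitRecOn with
  | zero =>
    intro n hn
    rw [mul_zero, iterDeriv_zero] at hn
    rw [iterDeriv_zero]
    exact hn.mono (inter_subset_inter_left _ (P.openBall_subset_closedBall n))
  | add_one a ih =>
    intro n hn
    by_contra hne
    rw [not_nonempty_iff_eq_empty, iterDeriv_add_one] at hne
    have hfin := finite_of_inter_cbDeriv_eq_empty (P.isClosed_closedBall n)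
      (isClosed_iterDeriv_cbDeriv hF a) hne
    obtain ⟨k, hk⟩ := hfin.exists_encard_eq_coe
    have hlt : ω * a + k ≤ ω * (a + 1) := by
      rw [mul_add_one]
      gcongr
      exact (Ordinal.natCast_lt_omega0 k).le
    have := P.lt_encard_of_mem_iterDeriv ih k n (iterDeriv_antitone P.deriv_subset _ hlt hn)
    rw [hk, Nat.cast_le] at this
    omega
  | limit a ha ih =>
    intro n hn
    have : Nonempty (Iio a) := ⟨⟨0, ha.bot_lt⟩⟩
    rw [iterDeriv_limit _ _ _ ha, inter_iInter]
    have hcl : ∀ c : Iio a, IsClosed (P.closedBall n ∩ iterDeriv cbDeriv F c.1) := fun c =>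
      (P.isClosed_closedBall n).inter (isClosed_iterDeriv_cbDeriv hF _)
    refine IsCompact.nonempty_iInter_of_directed_nonempty_isCompact_isClosed _ ?_ ?_
      (fun c => (hcl c).isCompact) hcl
    · exact directed_of_isDirected_le fun b c hbc =>
        inter_subset_inter_right _ (iterDeriv_antitone cbDeriv_subset F hbc)
    · intro c
      refine ih c.1 c.2 n (iterDeriv_antitone P.deriv_subset _ ?_ hn)
      gcongr
      exact c.2.le

theorem rank_lt_omega0_mul_cbRank {X : Type*} [TopologicalSpace X] [PolishSpace X]
    [CompactSpace X] (P : Presentation X) {F : Set X} (hF : F ∈ countableClosed X)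
    (hne : F.Nonempty) : P.rank F < ω * cbRank F := by
  obtain ⟨b, hb⟩ := exists_cbRank_eq_add_one hF hne
  have hempty : cbDeriv (iterDeriv cbDeriv F b) = ∅ := 
    (iterDeriv_add_one _ _ _).symm.trans (by rw [← hb, iterDeriv_cbRank hF])
  have hfin := finite_of_inter_cbDeriv_eq_empty isClosed_univ
    (isClosed_iterDeriv_cbDeriv hF.1 b) (by rw [hempty, inter_empty])
  rw [univ_inter] at hfin
  obtain ⟨k, hk⟩ := hfin.exists_encard_eq_coe
  have hle : P.rank F ≤ ω * b + k := by
    refine derivRank_le_of_eq_empty P.deriv_subset (eq_empty_of_forall_notMem fun n hn => ?_)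
    have h1 := P.lt_encard_of_mem_iterDeriv
      (P.closedBall_inter_nonempty_of_mem_iterDeriv hF.1 b) k n hn
    have h2 := h1.trans (encard_le_encard inter_subset_right)
    rw [hk, Nat.cast_le] at h2
    omega
  refine hle.trans_lt ?_
  rw [hb, mul_add_one]
  exact (add_lt_add_iff_left _).2 (Ordinal.natCast_lt_omega0 k)

theorem rank_empty {X : Type*} [TopologicalSpace X] (P : Presentation X) : P.rank ∅ = 0 := by
  refine nonpos_iff_eq_zero.1 (derivRank_le_of_eq_empty P.deriv_subset ?_)
  simp [iterDeriv_zero, code]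

end Presentation

/-! ### Shortening distances along a subset -/

section Shortcut

variable {X T : Type*} [MetricSpace X] [MetricSpace T]

/-- The length of the path from `x` to `y` that either is direct (`none`) or enters `T` at `s`,
moves to `t` inside `T`, and leaves `T` there (`some (s, t)`). -/
noncomputable def shortcutCost (p : T → X) (x y : X) : Option (T × T) → ℝ
  | none => dist x y
  | some (s, t) => dist x (p s) + dist s t + dist (p t) y

/-- The distance on `X` obtained from the given one by replacing the distances along `p : T → X`
with those of `T`. -/
noncomputable def shortcutDist (p : T → X) (x y : X) : ℝ :=
  ⨅ i, shortcutCost p x y i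

variable {p : T → X}

theorem shortcutCost_nonneg (x y : X) (i : Option (T × T)) : 0 ≤ shortcutCost p x y i := by
  rcases i with _ | ⟨s, t⟩ <;> simp only [shortcutCost] <;> positivity

theorem bddBelow_shortcutCost (x y : X) : BddBelow (range (shortcutCost p x y)) :=
  ⟨0, forall_mem_range.2 (shortcutCost_nonneg x y)⟩

theorem shortcutDist_le (x y : X) (i : Option (T × T)) :
    shortcutDist p x y ≤ shortcutCost p x y i :=
  ciInf_le (bddBelow_shortcutCost x y) i

theorem shortcutDist_le_dist (x y : X) : shortcutDist p x y ≤ dist x y :=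
  shortcutDist_le x y none

theorem shortcutDist_nonneg (x y : X) : 0 ≤ shortcutDist p x y :=
  le_ciInf (shortcutCost_nonneg x y)

theorem exists_shortcutCost_lt {x y : X} {c : ℝ} (h : shortcutDist p x y < c) :
    ∃ i, shortcutCost p x y i < c :=
  exists_lt_of_ciInf_lt h

theorem shortcutDist_comm (x y : X) : shortcutDist p x y = shortcutDist p y x := by
  have key : ∀ x y : X, shortcutDist p x y ≤ shortcutDist p y x := by
    refine fun x y => le_ciInf fun i => ?_
    rcases i with _ | ⟨s, t⟩
    · exact (shortcutDist_le x y none).trans_eq (dist_comm x y)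
    · refine (shortcutDist_le x y (some (t, s))).trans_eq ?_
      simp only [shortcutCost]
      rw [dist_comm x, dist_comm t, dist_comm _ y]
      ring
  exact le_antisymm (key x y) (key y x)

/-- Two consecutive shortcuts can be merged because `p` does not shrink distances. -/
theorem shortcutDist_triangle (hp : ∀ s t, dist s t ≤ dist (p s) (p t)) (x y z : X) :
    shortcutDist p x z ≤ shortcutDist p x y + shortcutDist p y z := by
  refine le_of_forall_pos_lt_add fun ε hε => ?_
  obtain ⟨i, hi⟩ := exists_shortcutCost_lt (lt_add_of_pos_right (shortcutDist p x y) (half_pos hε))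
  obtain ⟨j, hj⟩ := exists_shortcutCost_lt (lt_add_of_pos_right (shortcutDist p y z) (half_pos hε))
  suffices ∃ k, shortcutCost p x z k ≤ shortcutCost p x y i + shortcutCost p y z j by
    obtain ⟨k, hk⟩ := this
    linarith [shortcutDist_le (p := p) x z k]
  rcases i with _ | ⟨s, t⟩ <;> rcases j with _ | ⟨u, v⟩
  · exact ⟨none, dist_triangle x y z⟩
  · refine ⟨some (u, v), ?_⟩
    simp only [shortcutCost]
    linarith [dist_triangle x y (p u)]
  · refine ⟨some (s, t), ?_⟩
    simp only [shortcutCost]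
    linarith [dist_triangle (p t) y z]
  · refine ⟨some (s, v), ?_⟩
    simp only [shortcutCost]
    linarith [dist_triangle4 s t u v, dist_triangle s t v, dist_triangle t u v, hp t u,
      dist_triangle (p t) y (p u)]

theorem shortcutDist_apply_apply (hp : ∀ s t, dist s t ≤ dist (p s) (p t)) (s t : T) :
    shortcutDist p (p s) (p t) = dist s t := by
  apply le_antisymm
  · simpa [shortcutCost] using shortcutDist_le (p := p) (p s) (p t) (some (s, t))
  · refine le_ciInf fun i => ?_
    rcases i with _ | ⟨u, v⟩
    · exact hp s t
    · simp only [shortcutCost]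
      linarith [hp s u, hp v t, dist_triangle4 s u v t]

/-- Balls that stay away from the range of `p` are not affected by the shortcuts. -/
theorem dist_lt_of_shortcutDist_lt {x y : X} {c : ℝ} (h : shortcutDist p x y < c)
    (hc : c ≤ Metric.infDist x (range p)) : dist x y < c := by
  obtain ⟨_ | ⟨s, t⟩, hi⟩ := exists_shortcutCost_lt h
  · exact hi
  · have h1 : Metric.infDist x (range p) ≤ dist x (p s) :=
      Metric.infDist_le_dist_of_mem (mem_range_self s)
    simp only [shortcutCost] at hi
    linarith [dist_nonneg (x := s) (y := t), dist_nonneg (x := p t) (y := y)]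

/-- The key fact on `shortcutDist`: its Cauchy sequences converge for the original distance. If
the sequence stays away from the range of `p`, then it is Cauchy for the original distance,
and otherwise it is approximated by a Cauchy sequence in `T`. -/
theorem exists_tendsto_of_shortcutDist_cauchy [CompleteSpace X] [CompleteSpace T] [Nonempty T]
    (hp : ∀ s t, dist s t ≤ dist (p s) (p t)) (hcont : Continuous p) (y : ℕ → X)
    (hy : ∀ ε > 0, ∃ N, ∀ m ≥ N, ∀ n ≥ N, shortcutDist p (y m) (y n) < ε) :
    ∃ a, Tendsto y atTop (𝓝 a) := by
  by_cases h : Tendsto (fun n => Metric.infDist (y n) (range p)) atTop (𝓝 0)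
  · have hs : ∀ n : ℕ, ∃ s, dist (y n) (p s) < Metric.infDist (y n) (range p) + 1 / (n + 1) := by
      intro n
      obtain ⟨_, ⟨s, rfl⟩, hs⟩ := (Metric.infDist_lt_iff (range_nonempty p)).1
        (lt_add_of_pos_right (Metric.infDist (y n) (range p)) (Nat.one_div_pos_of_nat (n := n)))
      exact ⟨s, hs⟩
    choose s hs using hs
    have hlim : Tendsto (fun n => dist (y n) (p (s n))) atTop (𝓝 0) := by
      refine squeeze_zero (fun _ => dist_nonneg) (fun n => (hs n).le) ?_
      simpa using h.add tendsto_one_div_add_atTop_nhds_zero_nat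
    have hcau : CauchySeq s := by
      refine Metric.cauchySeq_iff.2 fun ε hε => ?_
      obtain ⟨N, hN⟩ := hy (ε / 3) (by positivity)
      obtain ⟨M, hM⟩ := eventually_atTop.1
        (hlim.eventually_lt_const (show (0 : ℝ) < ε / 3 by positivity))
      refine ⟨max M N, fun m hm n hn => ?_⟩
      rw [← shortcutDist_apply_apply hp]
      have h1 := shortcutDist_triangle hp (p (s m)) (y m) (p (s n))
      have h2 := shortcutDist_triangle hp (y m) (y n) (p (s n))
      have h3 := hN m (le_of_max_le_right hm) n (le_of_max_le_right hn)
      have h4 := hM m (le_of_max_le_left hm)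
      have h5 := hM n (le_of_max_le_left hn)
      have h6 := shortcutDist_le_dist (p := p) (y m) (p (s m))
      have h7 := shortcutDist_le_dist (p := p) (y n) (p (s n))
      rw [shortcutDist_comm] at h6
      linarith
    obtain ⟨t, ht⟩ := cauchySeq_tendsto_of_complete hcau
    refine ⟨p t, ((hcont.tendsto t).comp ht).congr_dist ?_⟩
    simpa [dist_comm] using hlim
  · obtain ⟨ε, hε, hfreq⟩ : ∃ ε > 0, ∀ N, ∃ n ≥ N, ε ≤ Metric.infDist (y n) (range p) := by
      by_contra! hcon
      refine h (Metric.tendsto_atTop.2 fun ε hε => ?_)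
      obtain ⟨N, hN⟩ := hcon ε hε
      refine ⟨N, fun n hn => ?_⟩
      rw [Real.dist_0_eq_abs, abs_of_nonneg Metric.infDist_nonneg]
      exact hN n hn
    obtain ⟨N, hN⟩ := hy (ε / 2) (half_pos hε)
    obtain ⟨n₀, hn₀, hn₀'⟩ := hfreq N
    have hfar : ∀ m ≥ N, ε / 2 ≤ Metric.infDist (y m) (range p) := by
      intro m hm
      have h1 := dist_lt_of_shortcutDist_lt (hN n₀ hn₀ m hm) (by linarith)
      linarith [Metric.infDist_le_infDist_add_dist (s := range p) (x := y n₀) (y := y m)]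
    refine cauchySeq_tendsto_of_complete (Metric.cauchySeq_iff.2 fun δ hδ => ?_)
    obtain ⟨M, hM⟩ := hy (min δ (ε / 2)) (by positivity)
    refine ⟨max M N, fun m hm n hn => ?_⟩
    exact (dist_lt_of_shortcutDist_lt (hM m (le_of_max_le_left hm) n (le_of_max_le_left hn))
      ((min_le_right _ _).trans (hfar m (le_of_max_le_right hm)))).trans_le (min_le_left _ _)

theorem tendsto_of_shortcutDist_tendsto [CompleteSpace X] [CompleteSpace T] [Nonempty T]
    (hp : ∀ s t, dist s t ≤ dist (p s) (p t)) (hcont : Continuous p) {y : ℕ → X} {x : X}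
    (hy : Tendsto (fun n => shortcutDist p (y n) x) atTop (𝓝 0)) : Tendsto y atTop (𝓝 x) := by
  -- The sequence `z` interleaving `y` with the constant sequence `x` is Cauchy, so it converges for
  -- the original distance, necessarily to `x`.
  let z : ℕ → X := fun n => if Even n then y (n / 2) else x
  have hz : Tendsto (fun n => shortcutDist p (z n) x) atTop (𝓝 0) := by
    have h0 : shortcutDist p x x = 0 :=
      le_antisymm ((shortcutDist_le_dist x x).trans_eq (dist_self x)) (shortcutDist_nonneg x x)
    refine squeeze_zero (fun _ => shortcutDist_nonneg _ _) (fun n => ?_)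
      (hy.comp (Nat.tendsto_div_const_atTop two_ne_zero))
    by_cases hn : Even n
    · simp [z, hn]
    · simp [z, hn, h0, shortcutDist_nonneg]
  obtain ⟨a, ha⟩ := exists_tendsto_of_shortcutDist_cauchy hp hcont z fun ε hε => by
    obtain ⟨N, hN⟩ := eventually_atTop.1 (hz.eventually_lt_const (half_pos hε))
    refine ⟨N, fun m hm n hn => ?_⟩
    have h1 := hN m hm
    have h2 := hN n hn
    rw [shortcutDist_comm] at h2
    linarith [shortcutDist_triangle hp (z m) x (z n)]
  have h1 : Tendsto (fun n => z (2 * n + 1)) atTop (𝓝 a) :=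
    ha.comp (tendsto_atTop_mono (fun n => by dsimp; omega) tendsto_id)
  have h2 : Tendsto (fun n => z (2 * n)) atTop (𝓝 a) :=
    ha.comp (tendsto_atTop_mono (fun n => by dsimp; omega) tendsto_id)
  have hx : a = x := tendsto_nhds_unique h1 (by simp [z])
  simpa [z, hx] using h2

theorem topology_le_of_tendsto_dist {X : Type*} (m m' : MetricSpace X)
    (h : ∀ (y : ℕ → X) (x : X), Tendsto (fun n => m.dist (y n) x) atTop (𝓝 0) →
      Tendsto (fun n => m'.dist (y n) x) atTop (𝓝 0)) :
    m.toUniformSpace.toTopologicalSpace ≤ m'.toUniformSpace.toTopologicalSpace := by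
  rw [← continuous_id_iff_le]
  refine @SeqContinuous.continuous X X m.toUniformSpace.toTopologicalSpace
    m'.toUniformSpace.toTopologicalSpace (by let := m; infer_instance) id fun y x hy => ?_
  exact (@tendsto_iff_dist_tendsto_zero X ℕ m'.toPseudoMetricSpace _ _ _).2
    (h y x ((@tendsto_iff_dist_tendsto_zero X ℕ m.toPseudoMetricSpace _ _ _).1 hy))

/-- The metric space structure given by `shortcutDist`. -/
noncomputable abbrev shortcutMetricSpace [CompleteSpace X] [CompleteSpace T] [Nonempty T]
    (hp : ∀ s t, dist s t ≤ dist (p s) (p t)) (hcont : Continuous p) : MetricSpace X where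
  dist := shortcutDist p
  dist_self := fun x =>
    le_antisymm ((shortcutDist_le_dist x x).trans_eq (dist_self x)) (shortcutDist_nonneg x x)
  dist_comm := shortcutDist_comm
  dist_triangle := shortcutDist_triangle hp
  eq_of_dist_eq_zero := fun {x y} h =>
    tendsto_nhds_unique tendsto_const_nhds (tendsto_of_shortcutDist_tendsto (y := fun _ => x)
      (x := y) hp hcont (by simp [show shortcutDist p x y = 0 from h]))

/-- Distances along a map `p : T → X` of complete metric spaces can be shortened to those of `T`
without changing the topology or losing completeness. -/
theorem exists_metricSpace_dist_apply_apply {X : Type*} [mX : MetricSpace X] {p : T → X}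
    [CompleteSpace X] [CompleteSpace T] [Nonempty T] (hp : ∀ s t, dist s t ≤ dist (p s) (p t)) (hcont : Continuous p) :
    ∃ m : MetricSpace X,
      m.toUniformSpace.toTopologicalSpace =mX.toUniformSpace.toTopologicalSpace ∧
      @CompleteSpace X m.toUniformSpace ∧ ∀ s t, m.dist (p s) (p t) = dist s t := by
  have hle : ∀ (y : ℕ → X) (x : X), Tendsto (fun n => dist (y n) x) atTop (𝓝 0) →
      Tendsto (fun n => shortcutDist p (y n) x) atTop (𝓝 0) := fun y x h =>
    squeeze_zero (fun _ => shortcutDist_nonneg _ _) (fun n => shortcutDist_le_dist _ _) h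
  refine ⟨shortcutMetricSpace hp hcont, le_antisymm ?_ ?_, ?_, shortcutDist_apply_apply hp⟩
  · exact topology_le_of_tendsto_dist (shortcutMetricSpace hp hcont) mX fun y x h =>
      tendsto_iff_dist_tendsto_zero.1 (tendsto_of_shortcutDist_tendsto hp hcont h)
  · exact topology_le_of_tendsto_dist mX (shortcutMetricSpace hp hcont) hle
  · refine @Metric.complete_of_cauchySeq_tendsto X
      (shortcutMetricSpace hp hcont).toPseudoMetricSpace fun y hy => ?_
    obtain ⟨a, ha⟩ := exists_tendsto_of_shortcutDist_cauchy hp hcont y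
      (@Metric.cauchySeq_iff X ℕ (shortcutMetricSpace hp hcont).toPseudoMetricSpace _ _ y |>.1 hy)
    exact ⟨a, (@tendsto_iff_dist_tendsto_zero X ℕ
      (shortcutMetricSpace hp hcont).toPseudoMetricSpace _ _ _).2
        (hle y a (tendsto_iff_dist_tendsto_zero.1 ha))⟩

end Shortcut

/-! ### The tree of descending sequences -/

/-- Finite sequences in `W × Bool` whose first components strictly decrease. A sequence is listed
backwards, with its last entry as the head of the list, so that its children are obtained
by `List.cons`. The component in `Bool` provides two children for each smaller element of `W`. -/
@[ext]
structure DescSeq (W : Type*) [LT W] where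
  /-- The entries of the sequence, the last one first. -/
  list : List (W × Bool)
  isChain : list.IsChain fun a b => a.1 < b.1

namespace DescSeq

variable {W : Type*} [LinearOrder W]

/-- The sequence as a function on `ℕ`, with value `none` from its length on. -/
def entry (s : DescSeq W) (n : ℕ) : Option (W × Bool) := s.list.reverse[n]?

theorem entry_injective : Function.Injective (entry : DescSeq W → ℕ → Option (W × Bool)) :=
  fun _ _ h => DescSeq.ext (List.reverse_injective (List.ext_getElem? (congrFun h)))

theorem entry_eq_none_iff {s : DescSeq W} {n : ℕ} : s.entry n = none ↔ s.list.length ≤ n := by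
  simp [entry]

theorem entry_cons_of_lt {l : List (W × Bool)} {c : W × Bool} (h) (h') {n : ℕ}
    (hn : n < l.length) : entry (⟨c :: l, h⟩ : DescSeq W) n = entry ⟨l, h'⟩ n := by
  simp only [entry, List.reverse_cons]
  exact List.getElem?_append_left (by simpa using hn)

theorem entry_cons_length {l : List (W × Bool)} {c : W × Bool} (h) :
    entry (⟨c :: l, h⟩ : DescSeq W) l.length = some c := by
  simp [entry]

theorem lt_of_entry_eq {s : DescSeq W} {n : ℕ} {a b : W × Bool} (ha : s.entry n = some a)
    (hb : s.entry (n + 1) = some b) : b.1 < a.1 := by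
  have h := List.isChain_reverse.2 s.isChain
  rw [List.isChain_iff_getElem] at h
  obtain ⟨h1, rfl⟩ := List.getElem?_eq_some_iff.1 ha
  obtain ⟨h2, rfl⟩ := List.getElem?_eq_some_iff.1 hb
  exact h n h2

open Classical in
/-- The distance of two distinct sequences is `(1 / 2) ^ (3 * k + 2)` for the first `k` at which
they differ. -/
noncomputable instance : Dist (DescSeq W) where
  dist s t := if s = t then 0 else (1 / 2) ^ (3 * PiNat.firstDiff s.entry t.entry + 2)

theorem dist_def_of_ne {s t : DescSeq W} (h : s ≠ t) :
    dist s t = (1 / 2 : ℝ) ^ (3 * PiNat.firstDiff s.entry t.entry + 2) :=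
  if_neg h

theorem dist_self' (s : DescSeq W) : dist s s = 0 := if_pos rfl

theorem dist_le_of_forall_entry_eq {s t : DescSeq W} {k : ℕ}
    (h : ∀ j < k, s.entry j = t.entry j) : dist s t ≤ (1 / 2 : ℝ) ^ (3 * k + 2) := by
  rcases eq_or_ne s t with rfl | hne
  · rw [dist_self']
    positivity
  · rw [dist_def_of_ne hne]
    refine pow_le_pow_of_le_one (by norm_num) (by norm_num) ?_
    by_contra! hlt
    exact PiNat.apply_firstDiff_ne (entry_injective.ne hne) (h _ (by omega))

theorem le_dist_of_entry_ne {s t : DescSeq W} {k : ℕ} (h : s.entry k ≠ t.entry k) :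
    (1 / 2 : ℝ) ^ (3 * k + 2) ≤ dist s t := by
  have hne : s ≠ t := by rintro rfl; exact h rfl
  rw [dist_def_of_ne hne]
  refine pow_le_pow_of_le_one (by norm_num) (by norm_num) ?_
  by_contra! hlt
  exact h (PiNat.apply_eq_of_lt_firstDiff (by omega))

theorem entry_eq_of_dist_lt {s t : DescSeq W} {k j : ℕ}
    (h : dist s t < (1 / 2 : ℝ) ^ (3 * k + 2)) (hj : j ≤ k) : s.entry j = t.entry j := by
  by_contra hne
  refine absurd (le_dist_of_entry_ne hne) (not_le.2 (h.trans_le ?_))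
  exact pow_le_pow_of_le_one (by norm_num) (by norm_num) (by omega)

theorem dist_le_one (s t : DescSeq W) : dist s t ≤ 1 :=
  (dist_le_of_forall_entry_eq (k := 0) (by simp)).trans (by norm_num)

theorem dist_nonneg' (s t : DescSeq W) : 0 ≤ dist s t := by
  rcases eq_or_ne s t with rfl | h
  · exact (dist_self' s).ge
  · rw [dist_def_of_ne h]; positivity

theorem dist_le_max (s t u : DescSeq W) : dist s u ≤ max (dist s t) (dist t u) := by
  rcases eq_or_ne s t with rfl | hst
  · exact le_max_right _ _
  rcases eq_or_ne t u with rfl | htu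
  · exact le_max_left _ _
  rcases eq_or_ne s u with rfl | hsu
  · rw [dist_self']
    exact le_max_of_le_left (dist_nonneg' s t)
  rw [dist_def_of_ne hst, dist_def_of_ne htu, dist_def_of_ne hsu, le_max_iff]
  rcases min_le_iff.1 (PiNat.min_firstDiff_le s.entry t.entry u.entry (entry_injective.ne hsu))
    with h | h
  · exact Or.inl (pow_le_pow_of_le_one (by norm_num) (by norm_num) (by omega))
  · exact Or.inr (pow_le_pow_of_le_one (by norm_num) (by norm_num) (by omega))

noncomputable instance : MetricSpace (DescSeq W) where
  dist_self := dist_self'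
  dist_comm s t := by
    rcases eq_or_ne s t with rfl | h
    · rfl
    · rw [dist_def_of_ne h, dist_def_of_ne h.symm, PiNat.firstDiff_comm]
  dist_triangle s t u := (dist_le_max s t u).trans
    (max_le_add_of_nonneg (dist_nonneg' s t) (dist_nonneg' t u))
  eq_of_dist_eq_zero {s t} h := by
    by_contra hne
    rw [dist_def_of_ne hne] at h
    exact (by positivity : (1 / 2 : ℝ) ^ (3 * PiNat.firstDiff s.entry t.entry + 2) ≠ 0) h

theorem eq_of_dist_lt {s t : DescSeq W} {k : ℕ} (h : dist t s < (1 / 2 : ℝ) ^ (3 * k + 2))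
    (hk : s.entry k = none) : t = s := by
  have hk' : t.entry k = none := (entry_eq_of_dist_lt h le_rfl).trans hk
  refine entry_injective (funext fun j => ?_)
  rcases le_total j k with hj | hj
  · exact entry_eq_of_dist_lt h hj
  · rw [entry_eq_none_iff.2 ((entry_eq_none_iff.1 hk).trans hj),
      entry_eq_none_iff.2 ((entry_eq_none_iff.1 hk').trans hj)]

instance : DiscreteTopology (DescSeq W) := by
  refine discreteTopology_iff_isOpen_singleton.2 fun s => ?_
  exact Metric.isOpen_singleton_iff.2 ⟨(1 / 2) ^ (3 * s.list.length + 2), by positivity,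
    fun t ht => eq_of_dist_lt ht (entry_eq_none_iff.2 le_rfl)⟩

/-- A Cauchy sequence converges entrywise. By well-foundedness of `W`, the limit has an entry
`none`, and then the sequence is eventually constant. -/
instance [WellFoundedLT W] : CompleteSpace (DescSeq W) := by
  refine Metric.complete_of_cauchySeq_tendsto fun u hu => ?_
  have hN : ∀ k : ℕ, ∃ N, ∀ n ≥ N, dist (u n) (u N) < (1 / 2 : ℝ) ^ (3 * k + 2) := fun k =>
    Metric.cauchySeq_iff'.1 hu _ (by positivity)
  choose N hN using hN
  by_cases h : ∃ k, (u (N k)).entry k = none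
  · obtain ⟨k, hk⟩ := h
    refine ⟨u (N k), tendsto_const_nhds.congr' ?_⟩
    filter_upwards [eventually_ge_atTop (N k)] with n hn
    exact (eq_of_dist_lt (hN k n hn) hk).symm
  · exfalso
    push Not at h
    choose x hx using fun k => Option.ne_none_iff_exists'.1 (h k)
    have hx' : ∀ k, ∀ n ≥ N k, (u n).entry k = some (x k) := fun k n hn =>
      (entry_eq_of_dist_lt (hN k n hn) le_rfl).trans (hx k)
    refine not_strictAnti_of_wellFoundedLT (fun k => (x k).1)
      (strictAnti_nat_of_succ_lt fun k => ?_)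
    exact lt_of_entry_eq (hx' k (max (N k) (N (k + 1))) (le_max_left _ _))
      (hx' (k + 1) (max (N k) (N (k + 1))) (le_max_right _ _))

instance [Countable W] : Countable (DescSeq W) :=
  Function.Injective.countable (f := DescSeq.list) fun _ _ => DescSeq.ext

instance : Nonempty (DescSeq W) := ⟨⟨[], List.isChain_nil⟩⟩

end DescSeq

/-! ### Presentations of large rank -/

theorem Topology.IsClosedEmbedding.exists_complete_metricSpace {X Y : Type*}
    [t : TopologicalSpace X] [MetricSpace Y] [CompleteSpace Y] {f : X → Y}
    (hf : IsClosedEmbedding f) :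
    ∃ m : MetricSpace X, m.toUniformSpace.toTopologicalSpace = t ∧
      @CompleteSpace X m.toUniformSpace ∧ ∀ x y, m.dist x y = dist (f x) (f y) := by
  refine ⟨hf.isEmbedding.comapMetricSpace f, rfl, ?_, fun _ _ => rfl⟩
  let : MetricSpace X := hf.isEmbedding.comapMetricSpace f
  rw [completeSpace_iff_isComplete_range hf.isEmbedding.to_isometry.isUniformInducing]
  exact hf.isClosed_range.isComplete

/-- A closed discrete subset of a Polish space is separated with respect to some complete
metric: add to a given metric the distance of the values of a continuous extension of an injection
of the subset into `ℕ`. -/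
theorem exists_metricSpace_one_le_dist {X : Type*} [t : TopologicalSpace X] [PolishSpace X]
    {F : Set X} (hF : IsClosed F) (hd : DiscreteTopology F) :
    ∃ m : MetricSpace X, m.toUniformSpace.toTopologicalSpace = t ∧
      @CompleteSpace X m.toUniformSpace ∧ ∀ x ∈ F, ∀ y ∈ F, x ≠ y → 1 ≤ m.dist x y := by
  let := TopologicalSpace.upgradeIsCompletelyMetrizable X
  have hc : Countable F := countable_of_Lindelof_of_discrete
  obtain ⟨e, he⟩ := exists_injective_nat F
  obtain ⟨g, hg⟩ := ContinuousMap.exists_restrict_eq hF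
    (⟨fun x => (e x : ℝ), continuous_of_discreteTopology⟩ : C(F, ℝ))
  have hge : ∀ x (hx : x ∈ F), g x = e ⟨x, hx⟩ := fun x hx => DFunLike.congr_fun hg ⟨x, hx⟩
  have hf : IsClosedEmbedding fun x => (x, g x) :=
    Function.LeftInverse.isClosedEmbedding (f := Prod.fst) (fun _ => rfl) continuous_fst
      (by fun_prop)
  have hsep : ∀ x ∈ F, ∀ y ∈ F, x ≠ y → 1 ≤ dist (x, g x) (y, g y) := by
    intro x hx y hy hxy
    rw [Prod.dist_eq]
    refine le_max_of_le_right ?_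
    rw [hge x hx, hge y hy, Nat.dist_cast_real]
    exact Nat.pairwise_one_le_dist (he.ne fun h => hxy (congrArg Subtype.val h))
  obtain ⟨m, hm, hcomp, hdist⟩ := hf.exists_complete_metricSpace
  exact ⟨m, hm, hcomp, fun x hx y hy hxy => (hsep x hx y hy hxy).trans_eq (hdist x y).symm⟩

namespace Presentation

variable {X : Type*} [TopologicalSpace X] (P : Presentation X)

theorem prec_of_dist_add_lt {n m : ℕ × ℕ} (hlt : n.2 < m.2)
    (h : P.metric.dist (P.seq m.1) (P.seq n.1) + (1 / 2) ^ (m.2 + 1) < (1 / 2) ^ (n.2 + 1)) :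
    P.Prec n m :=
  ⟨hlt, fun x (hx : P.metric.dist x (P.seq m.1) ≤ _) =>
    ((P.metric.dist_triangle x (P.seq m.1) (P.seq n.1)).trans_lt (by linarith))⟩

theorem incomp_of_lt_dist {n m : ℕ × ℕ}
    (h : (1 / 2) ^ (n.2 + 1) + (1 / 2) ^ (m.2 + 1) < P.metric.dist (P.seq n.1) (P.seq m.1)) :
    P.Incomp n m := by
  refine eq_empty_of_forall_notMem fun x hx => ?_
  have h1 : P.metric.dist x (P.seq n.1) ≤ (1 / 2) ^ (n.2 + 1) := hx.1
  have h2 : P.metric.dist x (P.seq m.1) ≤ (1 / 2) ^ (m.2 + 1) := hx.2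
  have h3 := P.metric.dist_triangle (P.seq n.1) x (P.seq m.1)
  rw [P.metric.dist_comm (P.seq n.1) x] at h3
  linarith

theorem exists_tendsto_of_dist_le {y : ℕ → X} {c : ℕ → ℕ}
    (h : ∀ i j, i ≤ j → P.metric.dist (y j) (P.seq (c i)) ≤ (1 / 2) ^ (i + 1)) :
    ∃ x, Tendsto y atTop (𝓝 x) ∧ ∀ i, P.metric.dist x (P.seq (c i)) ≤ (1 / 2) ^ (i + 1) := by
  revert h
  obtain ⟨m, rfl, hcomp, s, -⟩ := P
  intro h
  have hcau : CauchySeq y := by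
    refine cauchySeq_of_le_tendsto_0 (fun i => (1 / 2 : ℝ) ^ i) (fun j k i hj hk => ?_)
      (tendsto_pow_atTop_nhds_zero_of_lt_one (by norm_num) (by norm_num))
    exact (dist_triangle_right _ _ _).trans
      ((add_le_add (h i j hj) (h i k hk)).trans_eq (by rw [pow_succ]; ring))
  obtain ⟨x, hx⟩ := cauchySeq_tendsto_of_complete hcau
  exact ⟨x, hx, fun i => le_of_tendsto (hx.dist tendsto_const_nhds)
    (eventually_atTop.2 ⟨i, fun j hj => h i j hj⟩)⟩

theorem exists_dist_lt_imp_eq {F : Set X} (hd : DiscreteTopology F) {x : X} (hx : x ∈ F) :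
    ∃ ε > 0, ∀ z ∈ F, P.metric.dist z x < ε → z = x := by
  obtain ⟨m, rfl, -, -, -⟩ := P
  obtain ⟨ε, hε, hball⟩ := Metric.mem_nhdsWithin_iff.1
    (disjoint_principal_right.1 (disjoint_iff.2 (discreteTopology_subtype_iff.1 hd x hx)))
  exact ⟨ε, hε, fun z hz hzx => by_contra fun hne => hball ⟨hzx, hne⟩ hz⟩

/-- For a closed discrete set `F`, no nonempty set of indices of balls meeting `F` equals its
derivative: following a branch one finds a point of `F`, and balls close to an isolated
point of `F` do not contain disjoint balls that meet `F`. -/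
theorem eq_empty_of_deriv_eq {F : Set X} (hF : IsClosed F) (hd : DiscreteTopology F)
    {A : Set (ℕ × ℕ)} (hA : A ⊆ P.code F) (h : P.deriv A = A) : A = ∅ := by
  by_contra hne
  obtain ⟨n₀, hn₀⟩ := nonempty_iff_ne_empty.2 hne
  have hstep : ∀ n : A, ∃ u : A, P.Prec n u := fun n => by
    have hn : n.1 ∈ P.deriv A := h.symm ▸ n.2
    obtain ⟨-, u, hu, -, -, hnu, -⟩ := hn
    exact ⟨⟨u, hu⟩, hnu⟩
  choose next hnext using hstep
  let b : ℕ → A := fun i => next^[i] ⟨n₀, hn₀⟩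
  have hb : ∀ i, P.Prec (b i) (b (i + 1)) := fun i => by
    simp only [b, Function.iterate_succ_apply']
    exact hnext _
  have hanti : Antitone fun i => P.closedBall (b i) :=
    antitone_nat_of_succ_le fun i => (hb i).2.trans (P.openBall_subset_closedBall _)
  have hlevel : ∀ i, i ≤ (b i).1.2 := fun i => by
    induction i with
    | zero => exact Nat.zero_le _
    | succ i ih => exact ih.trans_lt (hb i).1
  choose y hyB hyF using fun i => hA (b i).2
  have hdist : ∀ i j, i ≤ j → P.metric.dist (y j) (P.seq (b i).1.1) ≤ (1 / 2) ^ (i + 1) :=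
    fun i j hij => (hanti hij (P.openBall_subset_closedBall _ (hyB j))).trans
      (pow_le_pow_of_le_one (by norm_num) (by norm_num) (by simpa using hlevel i))
  obtain ⟨x, hx, hxb⟩ := P.exists_tendsto_of_dist_le hdist
  have hxF : x ∈ F := hF.mem_of_tendsto hx (Eventually.of_forall hyF)
  obtain ⟨ε, hε, hball⟩ := P.exists_dist_lt_imp_eq hd hxF
  obtain ⟨i, hi⟩ := exists_pow_lt_of_lt_one hε (show (1 / 2 : ℝ) < 1 by norm_num)
  -- The `i`-th ball of the branch contains no point of `F` except `x`.
  have huniq : ∀ z ∈ F, z ∈ P.openBall (b i) → z = x := by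
    intro z hz hzi
    have h1 : (1 / 2 : ℝ) ^ ((b i).1.2 + 1) ≤ (1 / 2) ^ (i + 1) :=
      pow_le_pow_of_le_one (by norm_num) (by norm_num) (by simpa using hlevel i)
    have h2 : P.metric.dist z (P.seq (b i).1.1) < (1 / 2) ^ ((b i).1.2 + 1) := hzi
    have h3 := P.metric.dist_triangle z (P.seq (b i).1.1) x
    rw [P.metric.dist_comm (P.seq (b i).1.1) x] at h3
    have h4 := hxb i
    refine hball z hz ?_
    have h5 : (1 / 2 : ℝ) ^ (i + 1) = (1 / 2) ^ i * (1 / 2) := pow_succ _ _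
    linarith
  have hbi : (b i).1 ∈ P.deriv A := h.symm ▸ (b i).2
  obtain ⟨-, u, hu, v, hv, hnu, hnv, huv⟩ := hbi
  obtain ⟨zu, hzu, hzuF⟩ := hA hu
  obtain ⟨zv, hzv, hzvF⟩ := hA hv
  have hzu' := P.openBall_subset_closedBall _ hzu
  have hzv' := P.openBall_subset_closedBall _ hzv
  have h1 := huniq zu hzuF (hnu.2 hzu')
  have h2 := huniq zv hzvF (hnv.2 hzv')
  subst h1
  exact huv.subset ⟨hzu', h2 ▸ hzv'⟩

theorem le_rank_of_forall_iterDeriv_nonempty {F : Set X} (hF : IsClosed F)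
    (hd : DiscreteTopology F) {α : Ordinal}
    (h : ∀ b < α, (iterDeriv P.deriv (P.code F) b).Nonempty) : α ≤ P.rank F := by
  by_contra! hlt
  refine (h _ hlt).ne_empty (P.eq_empty_of_deriv_eq hF hd (iterDeriv_subset P.deriv_subset _ _) ?_)
  exact (iterDeriv_add_one _ _ _).symm.trans
    (iterDeriv_derivRank P.deriv_subset (to_countable (P.code F)))

/-- If `F` contains an isometric copy of the tree of descending sequences of ordinals
below `α`, then the ball of radius `(1 / 2) ^ (3 * k + 1)` about a sequence of length `k` with
last entry `w` survives `w` derivatives. This radius is twice the distance to the children, and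
the balls about the children are smaller by a factor `8`. -/
theorem mem_iterDeriv_of_isometric {F : Set X} {α : Ordinal.{0}} {p : DescSeq (Iio α) → X}
    (hpF : ∀ s, p s ∈ F) (hp : ∀ s t, P.metric.dist (p s) (p t) = dist s t)
    {ι : DescSeq (Iio α) → ℕ} (hι : ∀ s, P.seq (ι s) = p s) (o : Ordinal.{0}) :
    ∀ (c : Iio α × Bool) (l) (h), o ≤ c.1.1 →
      (ι ⟨c :: l, h⟩, 3 * (l.length + 1)) ∈ iterDeriv P.deriv (P.code F) o := by
  induction o using Ordinal.limitRecOn with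
  | zero =>
    intro c l h _
    rw [iterDeriv_zero]
    refine ⟨p ⟨c :: l, h⟩, ?_, hpF _⟩
    simp only [openBall, mem_ofPred_eq, hι, hp, dist_self]
    exact pow_pos (by norm_num) _
  | add_one o ih =>
    intro c l h hc
    have hlt : o < c.1.1 := Order.add_one_le_iff.1 hc
    have hchain : ∀ i : Bool, (((⟨o, hlt.trans c.1.2⟩, i) : Iio α × Bool) :: c :: l).IsChain
        fun a b => a.1 < b.1 := fun i => List.isChain_cons_cons.2 ⟨hlt, h⟩
    have hmem := fun i => ih (⟨o, hlt.trans c.1.2⟩, i) (c :: l) (hchain i) le_rfl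
    have hprec : ∀ i, P.Prec (ι ⟨c :: l, h⟩, 3 * (l.length + 1))
        (ι ⟨_, hchain i⟩, 3 * ((c :: l).length + 1)) := fun i => by
      refine P.prec_of_dist_add_lt (by simp) ?_
      have hle := DescSeq.dist_le_of_forall_entry_eq fun j hj =>
        DescSeq.entry_cons_of_lt (hchain i) h (n := j) hj
      simp only [hι, hp, List.length_cons] at hle ⊢
      refine (add_le_add_left hle _).trans_lt ?_
      have : (0 : ℝ) < (1 / 2) ^ (3 * (l.length + 1)) := by positivity
      rw [show 3 * (l.length + 1 + 1) + 1 = 3 * (l.length + 1) + 4 by ring, pow_add, pow_add,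
        pow_add]
      linarith
    rw [iterDeriv_add_one]
    refine ⟨ih c l h hlt.le, _, hmem false, _, hmem true, hprec false, hprec true,
      P.incomp_of_lt_dist ?_⟩
    have hne : DescSeq.entry ⟨_, hchain false⟩ (c :: l).length ≠
        DescSeq.entry ⟨_, hchain true⟩ (c :: l).length := by
      rw [DescSeq.entry_cons_length, DescSeq.entry_cons_length]
      simp
    have hle := DescSeq.le_dist_of_entry_ne hne
    simp only [hι, hp, List.length_cons] at hle ⊢
    refine lt_of_lt_of_le ?_ hle
    have : (0 : ℝ) < (1 / 2) ^ (3 * (l.length + 1)) := by positivity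
    rw [show 3 * (l.length + 1 + 1) + 1 = 3 * (l.length + 1) + 4 by ring, pow_add, pow_add]
    linarith
  | limit o ho ih =>
    intro c l h hc
    rw [iterDeriv_limit _ _ _ ho]
    exact mem_iInter.2 fun b => ih b.1 b.2 c l h (b.2.le.trans hc)

end Presentation

theorem countable_Iio_of_lt_omega_one {α : Ordinal.{0}} (hα : α < ω₁) : Countable (Iio α) := by
  rw [← Cardinal.mk_le_aleph0_iff, Cardinal.mk_Iio_ordinal, ← Cardinal.lift_aleph0.{1, 0},
    Cardinal.lift_le]
  rwa [Cardinal.lt_omega_iff_card_lt, ← zero_add 1, ← Cardinal.succ_aleph, Cardinal.aleph_zero,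
    Order.lt_succ_iff] at hα

/-- The space can be remetrized so that an infinite closed discrete set contains an isometric copy
of the tree of descending sequences of ordinals below `α`. -/
theorem exists_presentation_le_rank {X : Type*} [TopologicalSpace X] [PolishSpace X] {F : Set X}
    (hF : IsClosed F) (hd : DiscreteTopology F) (hinf : F.Infinite) {α : Ordinal.{0}}
    (hα : α < ω₁) : ∃ P : Presentation X, α ≤ P.rank F := by
  have := countable_Iio_of_lt_omega_one hα
  have hX : Nonempty X := hinf.nonempty.to_type
  obtain ⟨e, he⟩ := exists_injective_nat (DescSeq (Iio α))
  let p : DescSeq (Iio α) → X := fun s => hinf.natEmbedding F (e s)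
  have hpF : ∀ s, p s ∈ F := fun s => (hinf.natEmbedding F (e s)).2
  have hpinj : Function.Injective p :=
    Subtype.val_injective.comp ((hinf.natEmbedding F).injective.comp he)
  obtain ⟨q, hq⟩ : ∃ q : ℕ → X, range p ∪ range (TopologicalSpace.denseSeq X) = range q :=
    ((countable_range p).union (countable_range _)).exists_eq_range
      ((range_nonempty p).mono subset_union_left)
  have hqd : DenseRange q :=
    (TopologicalSpace.denseRange_denseSeq X).mono (hq ▸ subset_union_right)
  have hqp : ∀ s, ∃ n, q n = p s := fun s => hq.subset (Or.inl (mem_range_self s))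
  choose ι hι using hqp
  obtain ⟨P, hPq, hPp⟩ : ∃ P : Presentation X, P.seq = q ∧
      ∀ s t, P.metric.dist (p s) (p t) = dist s t := by
    obtain ⟨m₀, rfl, hcomp₀, hsep⟩ := exists_metricSpace_one_le_dist hF hd
    obtain ⟨m, hm, hcomp, hdist⟩ := exists_metricSpace_dist_apply_apply (p := p)
      (fun s t => by
        rcases eq_or_ne s t with rfl | hst
        · simp
        · exact (DescSeq.dist_le_one s t).trans (hsep _ (hpF s) _ (hpF t) (hpinj.ne hst)))
      continuous_of_discreteTopology
    exact ⟨@Presentation.mk X m₀.toUniformSpace.toTopologicalSpace m hm hcomp q hqd, rfl, hdist⟩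
  refine ⟨P, P.le_rank_of_forall_iterDeriv_nonempty hF hd fun b hb => ?_⟩
  exact ⟨_, P.mem_iterDeriv_of_isometric hpF hPp (fun s => hPq ▸ hι s) b (⟨b, hb⟩, false) []
    (List.isChain_singleton _) le_rfl⟩

/-! ### Compactness and uniform boundedness -/

theorem mainTheorem2 (X : Type*) [TopologicalSpace X] [PolishSpace X] :
    [ CompactSpace X,
      UniformlyBoundedBy (fun P : Presentation X => P.rank) cbRank (countableClosed X),
      ∀ P : Presentation X, ∀ F ∈ countableClosed X, F.Nonempty → P.rank F < ω * cbRank F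
    ].TFAE ∧
    (¬ CompactSpace X → ∀ F : Set X, IsClosed F → DiscreteTopology F → F.Infinite →
      ∀ α < ω₁, ∃ P : Presentation X, α ≤ P.rank F) := by
  refine ⟨?_, fun _ F hF hd hinf α hα => exists_presentation_le_rank hF hd hinf hα⟩
  tfae_have 1 → 3 := fun _ P F hF hne => P.rank_lt_omega0_mul_cbRank hF hne
  tfae_have 3 → 2 := by
    refine fun h => ⟨fun a => ω * a, fun a ha => ?_, fun P F hF => ?_⟩
    · exact Ordinal.isPrincipal_mul_omega 1 Ordinal.omega0_lt_omega_one ha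
    · rcases F.eq_empty_or_nonempty with rfl | hne
      · exact P.rank_empty.trans_le zero_le
      · exact (h P F hF hne).le
  tfae_have 2 → 1 := by
    rintro ⟨f, hf, hle⟩
    by_contra hX
    obtain ⟨F, hF, hd, hinf⟩ := exists_infinite_isClosed_discreteTopology hX
    have hc : F.Countable := countable_coe_iff.1 countable_of_Lindelof_of_discrete
    have hlt : cbRank F < ω₁ := (cbRank_le_one hd).trans_lt
      (Ordinal.one_lt_omega0.trans Ordinal.omega0_lt_omega_one)
    obtain ⟨P, hP⟩ := exists_presentation_le_rank hF hd hinf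
      (α := f (cbRank F) + 1) ((Cardinal.isSuccLimit_omega 1).add_one_lt (hf _ hlt))
    exact absurd (hP.trans (hle P F ⟨hF, hc⟩)) (not_le.2 (Order.lt_add_one_iff.2 le_rfl))
  tfae_finish
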